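/- Let $\xi_1=(1,0)$, $\xi_2=(-1,\sqrt3)/2$, $\xi_3=(-1,-\sqrt3)/2$ in $\mathbb R^2$. For an integer $n\ge 1$, the 3-side grid of size $n$ is (up to an affine transformation) the planar digraph $G$ whose vertices are the points $i\xi_1-j\xi_3$ with integers $i,j\ge 0$, $i+j\le n$, and whose edges are the ordered pairs $(u,v)$ of vertices with $v-u\in\{\xi_1,\xi_2,\xi_3\}$. Its bounded faces are little equilateral triangles, they fill a big equilateral triangle $\mathcal R$, and each of the three sides of $\mathcal R$ consists of $n$ edges; the edges contained in the sides are the boundary edges. A function $h:E(G)\to\mathbb R$ is a concave cocirculation if there is a concave function $g:\mathcal R\to\mathbb R$, affine on each little triangle, with $h(u,v)=g(v)-g(u)$ for every edge $(u,v)$. For $F\subseteq E(G)$ and $h_0:F\to\mathbb R$, let $\mathcal C(G,h_0)\subseteq\mathbb R^{E(G)}$ be the polyhedron of all concave cocirculations $h$ with $h(e)=h_0(e)$ for all $e\in F$. Theorem. There is an absolute constant $C$ such that for every positive integer $k$ there exist a 3-side grid $G$ of size $n\le Ck$ and a function $h_0:F\to\mathbb Z$, where $F$ is the set of edges of two sides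 of $G$, such that the polyhedron $\mathcal C(G,h_0)$ has a vertex $h$ with the following properties: (a) for some edge $e\in E(G)$, $h(e)$ is a rational number whose denominator in lowest terms equals $k$; (b) $h(e)$ is an integer for every boundary edge $e$ of $G$. -/

import Mathlib

noncomputable section

namespace TriGrid

/-- The Euclidean plane. -/
abbrev Plane : Type := EuclideanSpace ℝ (Fin 2)

/-- The three generating vectors `(1, 0)`, `(-1, √3) / 2`, `(-1, -√3) / 2`, with sum zero. -/
def xi : Fin 3 → Plane :=
  ![!₂[1, 0], !₂[-1 / 2, √3 / 2], !₂[-1 / 2, -√3 / 2]]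

/-- The lattice point `i • ξ₁ - j • ξ₃`; note that `-ξ₃ = (1, √3) / 2`. -/
def gridPoint (i j : ℕ) : Plane := (i : ℝ) • xi 0 - (j : ℝ) • xi 2

/-- The vertices of the 3-side grid of size `n` (sides with `n` edges each): the lattice points
in the big triangle with corners `0`, `n • ξ₁`, `- n • ξ₃`. -/
def vertices (n : ℕ) : Set Plane := {p | ∃ i j : ℕ, i + j ≤ n ∧ p = gridPoint i j}

/-- The directed edges `(u, v)` of the grid: pairs of vertices with `v - u ∈ {ξ₁, ξ₂, ξ₃}`. -/
def edges (n : ℕ) : Set (Plane × Plane) :=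
  {e | e.1 ∈ vertices n ∧ e.2 ∈ vertices n ∧ ∃ s : Fin 3, e.2 - e.1 = xi s}

/-- The region of the plane spanned by the grid (the big triangle). -/
def region (n : ℕ) : Set Plane := convexHull ℝ (vertices n)

/-- `u → v → w → u` is a 3-circuit of the grid. The little triangles (bounded faces) of the grid
are exactly the convex hulls of the 3-circuits. -/
def IsThreeCircuit (n : ℕ) (u v w : Plane) : Prop :=
  (u, v) ∈ edges n ∧ (v, w) ∈ edges n ∧ (w, u) ∈ edges n

/-- `h` is a concave cocirculation: `h(u, v) = g(v) - g(u)` on all edges `(u, v)`, for a function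
`g` that is concave on the region of the grid and affine on each little triangle. -/
def IsConcaveCocirculation (n : ℕ) (h : edges n → ℝ) : Prop :=
  ∃ g : Plane → ℝ,
    ConcaveOn ℝ (region n) g ∧
    (∀ u v w : Plane, IsThreeCircuit n u v w →
      ∃ a : Plane →ᵃ[ℝ] ℝ, Set.EqOn g a (convexHull ℝ {u, v, w})) ∧
    ∀ e : edges n, h e = g e.1.2 - g e.1.1

/-- The polyhedron `𝒞(G, h₀)` in `ℝ^E`: the concave cocirculations that coincide with `h₀` on the
set `F` of edges. -/
def polyhedron (n : ℕ) (F : Set (edges n)) (h₀ : F → ℝ) : Set (edges n → ℝ) :=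
  {h | IsConcaveCocirculation n h ∧ ∀ e : F, h e.1 = h₀ e}

/-- The corners of the big triangle. -/
def corner (n : ℕ) : Fin 3 → Plane := ![gridPoint 0 0, gridPoint n 0, gridPoint 0 n]

/-- The set of edges in the `s`-th side of the grid (the side joining the corners `s` and `s + 1`,
taken modulo 3). -/
def side (n : ℕ) (s : Fin 3) : Set (edges n) :=
  {e | e.1.1 ∈ segment ℝ (corner n s) (corner n (s + 1)) ∧
       e.1.2 ∈ segment ℝ (corner n s) (corner n (s + 1))}

/-- The set of boundary edges of the grid. -/
def boundary (n : ℕ) : Set (edges n) := ⋃ s : Fin 3, side n s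

end TriGrid

end

/-!
Concave cocirculations on the grid of size `n` are handled through the differences of the concave
function `g` along the edges of direction `ξ₁`. Write `b p q` for the difference along the edge
from `(p, j)` to `(p + 1, j)`, where `q = n - 1 - p - j` is the number of edges to the right of it
in its row. Two of the three families of rhombus inequalities say exactly that `b` is antitone in
`p` and monotone in `q` (a Gelfand-Tsetlin pattern), and the sums of `b` over the antidiagonals
`p + q = S` are differences of `g` between the two slanted sides. Hence prescribing `h` on the
slanted sides prescribes all antidiagonal sums, and the third family of rhombus inequalities is
slack as soon as `g` is very concave along the left side.

So it suffices to find, for `n = 2 * k + 4`, a pattern with integral antidiagonal sums, with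
integral longest antidiagonal (this is the bottom side of the grid), with an entry `1 / k`, and
determined by its antidiagonal sums together with its tiles, the regions on which it is constant.
The pattern `entry` has the rectangle `p < k`, `1 ≤ q ≤ k` as a tile of value `d`, surrounded by
tiles of values `u`, `z`, `v` and by two lines of single cells, `(p, 0)` and `(k, q)`. The last
three antidiagonals determine `u`, `z` and `v`; the antidiagonal `S = k` then reads
`k * d + v = 0`, and the tile `d` gets the value `1 / k` because `v = -1`. The antidiagonals with
`S < k` or `k < S < 2 * k` contain one single cell each, which takes up the fractional part
(`IsTiled.eq_of_rowSum_eq`).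

*Existence.* `height` integrates the pattern, with a strongly concave summand in the row number.
Its concave envelope is affine on each little triangle, because every little triangle spans an
affine majorant: in the two rows it meets by monotonicity of the pattern, in all other rows by the
strong concavity (`height_le_majorant`, `exists_majorant`, `envelope_eqOn`).

*Extremality.* If the cocirculation is a proper convex combination of `h₁` and `h₂` in the
polyhedron, then the patterns of `h₁` and `h₂` are monotone as well, so wherever two comparable
entries of the combination agree, those of `h₁` agree. Thus the pattern of `h₁` is constant on the
same tiles and has the same antidiagonal sums, and it equals `entry`.
-/

namespace TriGrid

open Finset

/-! ### The Gelfand-Tsetlin pattern -/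

/-- The numerators, over the common denominator `k`, of the pattern `entry`. -/
def entryNum (k p q : ℕ) : ℤ :=
  if q = 0 then -(min p k : ℕ)
  else if p < k then (if q ≤ k then 1 else k)
  else if p = k then (if q ≤ k then q - k else if q = k + 1 then 0 else k)
  else if k ≤ q ∧ p ≤ k + 2 then 0 else -k

/-- The pattern with an entry `1 / k`. Only the cells with `p + q ≤ 2 * k + 3` matter; the formula
keeps the pattern monotone on all of `ℕ × ℕ`, so that truncated subtractions in the second argument
do no harm. -/
noncomputable def entry (k p q : ℕ) : ℝ := entryNum k p q / k

lemma entryNum_le_succ_right {k : ℕ} (hk : 0 < k) (p q : ℕ) :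
    entryNum k p q ≤ entryNum k p (q + 1) := by
  unfold entryNum; split_ifs <;> first | contradiction | omega

lemma entryNum_succ_left_le {k : ℕ} (hk : 0 < k) (p q : ℕ) :
    entryNum k (p + 1) q ≤ entryNum k p q := by
  unfold entryNum; split_ifs <;> first | contradiction | omega

lemma abs_entryNum_le {k : ℕ} (hk : 0 < k) (p q : ℕ) : |entryNum k p q| ≤ k := by
  rw [abs_le]; unfold entryNum; split_ifs <;> omega

lemma entry_le_entry {k : ℕ} (hk : 0 < k) {p p' q q' : ℕ} (hp : p ≤ p') (hq : q' ≤ q) :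
    entry k p' q' ≤ entry k p q := by
  have h : entryNum k p' q' ≤ entryNum k p q :=
    (antitone_nat_of_succ_le (f := fun x => entryNum k x q')
      (fun x => entryNum_succ_left_le hk x q') hp).trans
      (monotone_nat_of_le_succ (entryNum_le_succ_right hk p) hq)
  unfold entry
  gcongr

lemma abs_entry_le_one {k : ℕ} (hk : 0 < k) (p q : ℕ) : |entry k p q| ≤ 1 := by
  have h : |(entryNum k p q : ℝ)| ≤ k := by exact_mod_cast abs_entryNum_le hk p q
  have hk' : (0 : ℝ) < k := by exact_mod_cast hk
  rw [entry, abs_div, abs_of_pos hk', div_le_one hk']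
  exact h

/-- The array `b` is constant on the tiles of the pattern `entry`, within the triangle
`p + q ≤ 2 * k + 3`, with the values `d`, `u`, `z`, `v`. The cells `(p, 0)` with `p < k` and
`(k, q)` with `0 < q < k` belong to no tile. -/
structure IsTiled (k : ℕ) (b : ℕ → ℕ → ℝ) (d u z v : ℝ) : Prop where
  low : ∀ p q, p < k → 1 ≤ q → q ≤ k → b p q = d
  up : ∀ p q, p < k → k < q → p + q ≤ 2 * k + 3 → b p q = u
  upTop : ∀ q, k + 2 ≤ q → q ≤ k + 3 → b k q = u
  mid : ∀ p q, k ≤ p → p ≤ k + 2 → k ≤ q → (p = k → q ≤ k + 1) → p + q ≤ 2 * k + 3 → b p q = z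
  right : ∀ p q, k < p → q < k → p + q ≤ 2 * k + 3 → b p q = v
  rightFirst : b k 0 = v
  rightLast : b (k + 3) k = v

lemma isTiled_entry {k : ℕ} (hk : 0 < k) : IsTiled k (entry k) (1 / k) 1 0 (-1) := by
  have hk' : (k : ℝ) ≠ 0 := by positivity
  have key : ∀ p q (c : ℤ), entryNum k p q = c → entry k p q = c / k := by
    intro p q c h; rw [entry, h]
  refine ⟨fun p q h1 h2 h3 => ?_, fun p q h1 h2 h3 => ?_, fun q h1 h2 => ?_,
    fun p q h1 h2 h3 h4 h5 => ?_, fun p q h1 h2 h3 => ?_, ?_, ?_⟩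
  · rw [key p q 1 (by unfold entryNum; split_ifs <;> omega)]; simp
  · rw [key p q k (by unfold entryNum; split_ifs <;> omega)]; simp [hk']
  · rw [key k q k (by unfold entryNum; split_ifs <;> omega)]; simp [hk']
  · rw [key p q 0 (by unfold entryNum; split_ifs <;> omega)]; simp
  · rw [key p q (-k) (by unfold entryNum; split_ifs <;> omega)]; simp [hk']
  · rw [key k 0 (-k) (by unfold entryNum; split_ifs <;> omega)]; simp [hk']
  · rw [key (k + 3) k (-k) (by unfold entryNum; split_ifs <;> omega)]; simp [hk']

/-- The sum of the array `b` over the antidiagonal `p + q = S`. -/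
def rowSum (b : ℕ → ℕ → ℝ) (S : ℕ) : ℝ := ∑ p ∈ range (S + 1), b p (S - p)

namespace IsTiled

variable {k : ℕ} {b b' : ℕ → ℕ → ℝ} {d u z v d' u' z' v' : ℝ}

lemma rowSum_of_le (h : IsTiled k b d u z v) {S : ℕ} (hS : S ≤ k) :
    rowSum b S = S * d + b S 0 := by
  rw [rowSum, sum_range_succ, Nat.sub_self,
    sum_congr rfl fun p hp => h.low p (S - p) (by grind) (by grind) (by grind)]
  simp

lemma rowSum_add (h : IsTiled k b d u z v) {j : ℕ} (hj : j ≤ k) :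
    rowSum b (k + j) = j * u + (k - j) * d + b k j + j * v := by
  obtain ⟨m, rfl⟩ := Nat.exists_eq_add_of_le hj
  rw [rowSum, show j + m + j + 1 = j + m + 1 + j by ring, sum_range_add, sum_range_succ,
    sum_range_add,
    sum_congr rfl fun p hp => h.up p _ (by grind) (by grind) (by grind),
    sum_congr rfl fun p hp => h.low _ _ (by grind) (by grind) (by grind),
    sum_congr rfl fun p hp => h.right _ _ (by grind) (by grind) (by grind),
    show j + m + j - (j + m) = j by omega]
  simp

lemma rowSum_long (h : IsTiled k b d u z v) :
    rowSum b (2 * k + 1) = k * u + 2 * z + k * v ∧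
    rowSum b (2 * k + 2) = (k + 1) * u + 2 * z + k * v ∧
    rowSum b (2 * k + 3) = (k + 1) * u + 2 * z + (k + 1) * v := by
  have hl : ∀ S, 2 * k + 1 ≤ S → S ≤ 2 * k + 3 → ∑ p ∈ range k, b p (S - p) = k * u := by
    intro S h1 h2
    rw [sum_congr rfl fun p hp => h.up p _ (by grind) (by grind) (by grind)]
    simp
  have hr : ∀ S c, c + k = S + 1 → S ≤ 2 * k + 3 → k < c →
      ∑ p ∈ range k, b (c + p) (S - (c + p)) = k * v := by
    intro S c h1 h2 h3
    rw [sum_congr rfl fun p hp => h.right _ _ (by grind) (by grind) (by grind)]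
    simp
  refine ⟨?_, ?_, ?_⟩
  · rw [rowSum, show 2 * k + 1 + 1 = k + 1 + 1 + k by ring, sum_range_add, sum_range_succ,
      sum_range_succ, hl _ (by omega) (by omega), hr _ _ (by omega) (by omega) (by omega),
      h.mid k _ (by omega) (by omega) (by omega) (by omega) (by omega),
      h.mid (k + 1) _ (by omega) (by omega) (by omega) (by omega) (by omega)]
    ring
  · rw [rowSum, show 2 * k + 2 + 1 = k + 1 + 1 + 1 + k by ring, sum_range_add, sum_range_succ,
      sum_range_succ, sum_range_succ, hl _ (by omega) (by omega),
      hr _ _ (by omega) (by omega) (by omega), h.upTop _ (by omega) (by omega),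
      h.mid (k + 1) _ (by omega) (by omega) (by omega) (by omega) (by omega),
      h.mid (k + 1 + 1) _ (by omega) (by omega) (by omega) (by omega) (by omega)]
    ring
  · rw [rowSum, show 2 * k + 3 + 1 = k + 1 + 1 + 1 + 1 + k by ring, sum_range_add,
      sum_range_succ, sum_range_succ, sum_range_succ, sum_range_succ,
      hl _ (by omega) (by omega), hr _ _ (by omega) (by omega) (by omega),
      h.upTop _ (by omega) (by omega),
      h.mid (k + 1) _ (by omega) (by omega) (by omega) (by omega) (by omega),
      h.mid (k + 1 + 1) _ (by omega) (by omega) (by omega) (by omega) (by omega),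
      show 2 * k + 3 - (k + 1 + 1 + 1) = k by omega, h.rightLast]
    ring

/-- The tiles and the antidiagonal sums determine an array. -/
theorem eq_of_rowSum_eq (hk : 0 < k) (h : IsTiled k b d u z v) (h' : IsTiled k b' d' u' z' v')
    (hsum : ∀ S ≤ 2 * k + 3, rowSum b S = rowSum b' S) {p q : ℕ} (hpq : p + q ≤ 2 * k + 3) :
    b p q = b' p q := by
  obtain ⟨s1, s2, s3⟩ := h.rowSum_long
  obtain ⟨t1, t2, t3⟩ := h'.rowSum_long
  have e1 := hsum (2 * k + 1) (by omega)
  have e2 := hsum (2 * k + 2) (by omega)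
  have e3 := hsum (2 * k + 3) (by omega)
  have hu : u = u' := by linarith
  have hv : v = v' := by linarith
  subst hu hv
  have hz : z = z' := by linarith
  subst hz
  have hd : d = d' := by
    have e := hsum k (by omega)
    rw [h.rowSum_of_le le_rfl, h'.rowSum_of_le le_rfl, h.rightFirst, h'.rightFirst] at e
    have hk' : (k : ℝ) ≠ 0 := by positivity
    exact mul_left_cancel₀ hk' (by linarith)
  subst hd
  have hq0 : ∀ p ≤ k, b p 0 = b' p 0 := by
    intro p hp
    have e := hsum p (by omega)
    rw [h.rowSum_of_le hp, h'.rowSum_of_le hp] at e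
    linarith
  have hpk : ∀ q ≤ k, b k q = b' k q := by
    intro q hq
    have e := hsum (k + q) (by omega)
    rw [h.rowSum_add hq, h'.rowSum_add hq] at e
    linarith
  rcases lt_trichotomy p k with hp | rfl | hp
  · rcases Nat.eq_zero_or_pos q with rfl | hq
    · exact hq0 p hp.le
    · rcases le_or_gt q k with hq' | hq'
      · rw [h.low p q hp hq hq', h'.low p q hp hq hq']
      · rw [h.up p q hp hq' hpq, h'.up p q hp hq' hpq]
  · rcases le_or_gt q p with hq | hq
    · exact hpk q hq
    · rcases Nat.lt_or_ge q (p + 2) with hq' | hq'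
      · rw [h.mid p q, h'.mid p q] <;> omega
      · rw [h.upTop q hq' (by omega), h'.upTop q hq' (by omega)]
  · rcases lt_or_ge q k with hq | hq
    · rw [h.right p q hp hq hpq, h'.right p q hp hq hpq]
    · rcases Nat.lt_or_ge (k + 2) p with hp' | hp'
      · obtain rfl : p = k + 3 := by omega
        obtain rfl : q = k := by omega
        rw [h.rightLast, h'.rightLast]
      · rw [h.mid p q, h'.mid p q] <;> omega

end IsTiled

lemma entry_column {k : ℕ} (hk : 0 < k) {j : ℕ} (hj : j ≤ k) : entry k k j = j / k - 1 := by
  have hk' : (k : ℝ) ≠ 0 := by positivity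
  have : entryNum k k j = j - k := by unfold entryNum; split_ifs <;> omega
  rw [entry, this]; push_cast; field_simp

lemma rowSum_entry_int {k : ℕ} (hk : 0 < k) {S : ℕ} (hS : S ≤ 2 * k + 3) :
    ∃ m : ℤ, rowSum (entry k) S = m := by
  have hk' : (k : ℝ) ≠ 0 := by positivity
  have h := isTiled_entry hk
  obtain ⟨s1, s2, s3⟩ := h.rowSum_long
  rcases le_or_gt S k with h1 | h1
  · refine ⟨0, ?_⟩
    have : entryNum k S 0 = -S := by unfold entryNum; split_ifs <;> omega
    rw [h.rowSum_of_le h1, entry, this]; push_cast; field_simp; ring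
  rcases le_or_gt S (2 * k) with h2 | h2
  · refine ⟨0, ?_⟩
    obtain ⟨j, rfl⟩ := Nat.exists_eq_add_of_lt h1
    rw [add_assoc, h.rowSum_add (by omega), entry_column hk (by omega)]; push_cast; field_simp; ring
  obtain rfl | rfl | rfl : S = 2 * k + 1 ∨ S = 2 * k + 2 ∨ S = 2 * k + 3 := by omega
  · exact ⟨0, by rw [s1]; push_cast; ring⟩
  · exact ⟨1, by rw [s2]; push_cast; ring⟩
  · exact ⟨0, by rw [s3]; push_cast; ring⟩

/-- The longest antidiagonal of the pattern, which is the bottom side of the grid, is integral. -/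
lemma entry_last_int {k : ℕ} (hk : 0 < k) {p q : ℕ} (h : p + q = 2 * k + 3) :
    ∃ m : ℤ, entry k p q = m := by
  have hk' : (k : ℝ) ≠ 0 := by positivity
  have : entryNum k p q = k ∨ entryNum k p q = 0 ∨ entryNum k p q = -k := by
    unfold entryNum; split_ifs <;> first | contradiction | omega
  unfold entry
  rcases this with h | h | h <;> rw [h]
  · exact ⟨1, by simp [hk']⟩
  · exact ⟨0, by simp⟩
  · exact ⟨-1, by simp [hk']⟩

/-! ### Coordinates and little triangles of the grid -/

/-- The second coordinate with respect to the basis `ξ₁`, `-ξ₃`. -/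
noncomputable def coordJ : Plane →ₗ[ℝ] ℝ :=
  (2 / √3) • (EuclideanSpace.proj (𝕜 := ℝ) (1 : Fin 2)).toLinearMap

/-- The first coordinate with respect to the basis `ξ₁`, `-ξ₃`. -/
noncomputable def coordI : Plane →ₗ[ℝ] ℝ :=
  (EuclideanSpace.proj (𝕜 := ℝ) (0 : Fin 2)).toLinearMap - (1 / 2 : ℝ) • coordJ

@[simp] lemma coordI_xi (s : Fin 3) : coordI (xi s) = ![1, -1, 0] s := by
  have h3 : √3 ≠ 0 := by positivity
  fin_cases s <;> simp [coordI, coordJ, xi] <;> field_simp <;> norm_num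

@[simp] lemma coordJ_xi (s : Fin 3) : coordJ (xi s) = ![0, 1, -1] s := by
  have h3 : √3 ≠ 0 := by positivity
  fin_cases s <;> simp [coordJ, xi]

@[simp] lemma coordI_gridPoint (i j : ℕ) : coordI (gridPoint i j) = i := by simp [gridPoint]

@[simp] lemma coordJ_gridPoint (i j : ℕ) : coordJ (gridPoint i j) = j := by simp [gridPoint]

lemma ext_coord {x y : Plane} (hI : coordI x = coordI y) (hJ : coordJ x = coordJ y) : x = y := by
  have h3 : √3 ≠ 0 := by positivity
  have h1 : x 1 = y 1 := by simpa [coordJ, h3] using hJ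
  have h0 : x 0 = y 0 := by
    have : coordI x + (1 / 2) * coordJ x = coordI y + (1 / 2) * coordJ y := by rw [hI, hJ]
    simpa [coordI] using this
  ext t
  fin_cases t
  · exact h0
  · exact h1

@[simp] lemma gridPoint_inj {i j i' j' : ℕ} :
    gridPoint i j = gridPoint i' j' ↔ i = i' ∧ j = j' := by
  constructor
  · intro h
    have hI := congrArg coordI h
    have hJ := congrArg coordJ h
    simp only [coordI_gridPoint, coordJ_gridPoint, Nat.cast_inj] at hI hJ
    exact ⟨hI, hJ⟩
  · rintro ⟨rfl, rfl⟩; rfl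

lemma gridPoint_mem_vertices {n i j : ℕ} (h : i + j ≤ n) : gridPoint i j ∈ vertices n :=
  ⟨i, j, h, rfl⟩

lemma gridPoint_mem_region {n i j : ℕ} (h : i + j ≤ n) : gridPoint i j ∈ region n :=
  subset_convexHull ℝ _ (gridPoint_mem_vertices h)

lemma edge_horizontal_mem {n i j : ℕ} (h : i + j + 1 ≤ n) :
    (gridPoint i j, gridPoint (i + 1) j) ∈ edges n :=
  ⟨gridPoint_mem_vertices (by omega), gridPoint_mem_vertices (by omega), 0,
    ext_coord (by simp) (by simp)⟩

lemma edge_falling_mem {n i j : ℕ} (h : i + j + 1 ≤ n) :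
    (gridPoint (i + 1) j, gridPoint i (j + 1)) ∈ edges n :=
  ⟨gridPoint_mem_vertices (by omega), gridPoint_mem_vertices (by omega), 1,
    ext_coord (by simp) (by simp)⟩

lemma edge_rising_mem {n i j : ℕ} (h : i + j + 1 ≤ n) :
    (gridPoint i (j + 1), gridPoint i j) ∈ edges n :=
  ⟨gridPoint_mem_vertices (by omega), gridPoint_mem_vertices (by omega), 2,
    ext_coord (by simp) (by simp)⟩

lemma edges_cases {n : ℕ} {u v : Plane} (h : (u, v) ∈ edges n) :
    ∃ i j, i + j + 1 ≤ n ∧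
      (u = gridPoint i j ∧ v = gridPoint (i + 1) j ∨
       u = gridPoint (i + 1) j ∧ v = gridPoint i (j + 1) ∨
       u = gridPoint i (j + 1) ∧ v = gridPoint i j) := by
  obtain ⟨⟨i, j, hij, rfl⟩, ⟨i', j', hij', rfl⟩, s, hs⟩ := h
  have hI := congrArg coordI hs
  have hJ := congrArg coordJ hs
  simp only [gridPoint_inj]
  dsimp only at hI hJ hij hij'
  simp only [map_sub, coordI_gridPoint, coordJ_gridPoint, coordI_xi, coordJ_xi] at hI hJ
  fin_cases s <;> simp at hI hJ
  · have h1 : i' = i + 1 := by exact_mod_cast (by linarith : (i' : ℝ) = i + 1)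
    have h2 : j' = j := by exact_mod_cast (by linarith : (j' : ℝ) = j)
    exact ⟨i, j, by omega, by omega⟩
  · have h1 : i = i' + 1 := by exact_mod_cast (by linarith : (i : ℝ) = i' + 1)
    have h2 : j' = j + 1 := by exact_mod_cast (by linarith : (j' : ℝ) = j + 1)
    exact ⟨i', j, by omega, by omega⟩
  · have h1 : i' = i := by exact_mod_cast (by linarith : (i' : ℝ) = i)
    have h2 : j = j' + 1 := by exact_mod_cast (by linarith : (j : ℝ) = j' + 1)
    exact ⟨i, j', by omega, by omega⟩

lemma isThreeCircuit_up {n i j : ℕ} (h : i + j + 1 ≤ n) :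
    IsThreeCircuit n (gridPoint i j) (gridPoint (i + 1) j) (gridPoint i (j + 1)) :=
  ⟨edge_horizontal_mem h, edge_falling_mem h, edge_rising_mem h⟩

/-- Every 3-circuit bounds an upward or a downward little triangle. -/
lemma IsThreeCircuit.subset {n : ℕ} {u v w : Plane} (h : IsThreeCircuit n u v w) :
    ∃ i j, (i + j + 1 ≤ n ∧
        ({u, v, w} : Set Plane) ⊆ {gridPoint i j, gridPoint (i + 1) j, gridPoint i (j + 1)}) ∨
      (i + j + 2 ≤ n ∧ ({u, v, w} : Set Plane) ⊆
        {gridPoint (i + 1) j, gridPoint i (j + 1), gridPoint (i + 1) (j + 1)}) := by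
  obtain ⟨h1, h2, h3⟩ := h
  obtain ⟨a, b, hab, rfl⟩ := h1.1
  obtain ⟨c, d, hcd, rfl⟩ := h2.1
  obtain ⟨e, f, hef, rfl⟩ := h3.1
  obtain ⟨i1, j1, l1, h1⟩ := edges_cases h1
  obtain ⟨i2, j2, l2, h2⟩ := edges_cases h2
  obtain ⟨i3, j3, l3, h3⟩ := edges_cases h3
  simp only [gridPoint_inj] at h1 h2 h3
  simp only [Set.insert_subset_iff, Set.singleton_subset_iff, Set.mem_insert_iff,
    Set.mem_singleton_iff, gridPoint_inj]
  rcases h1 with h1 | h1 | h1 <;> rcases h2 with h2 | h2 | h2 <;> rcases h3 with h3 | h3 | h3 <;>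
    first
    | exfalso; omega
    | exact ⟨i1, j1, Or.inl (by omega)⟩
    | exact ⟨i1, j1 - 1, Or.inr (by omega)⟩
    | exact ⟨i1, j1, Or.inr (by omega)⟩
    | exact ⟨i1 - 1, j1, Or.inr (by omega)⟩

/-! ### Concave envelopes -/

/-- The concave envelope of a function `f` on the vertices of the grid, as the infimum of its affine
majorants. Outside of the region of the grid the infimum may be over an unbounded family, and its
value is irrelevant. -/
noncomputable def envelope (n : ℕ) (f : ℕ → ℕ → ℝ) (x : Plane) : ℝ :=
  ⨅ L : {L : Plane →ᵃ[ℝ] ℝ // ∀ i j, i + j ≤ n → f i j ≤ L (gridPoint i j)}, L.1 x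

section envelope

variable {n : ℕ} {f : ℕ → ℕ → ℝ}

lemma bddBelow_envelope {x : Plane} (hx : x ∈ region n) :
    BddBelow (Set.range fun L : {L : Plane →ᵃ[ℝ] ℝ //
      ∀ i j, i + j ≤ n → f i j ≤ L (gridPoint i j)} => L.1 x) := by
  obtain ⟨m, hm⟩ :=
    ((range (n + 1) ×ˢ range (n + 1)).image fun t : ℕ × ℕ => f t.1 t.2).bddBelow
  refine ⟨m, ?_⟩
  rintro _ ⟨L, rfl⟩
  have hsub : region n ⊆ L.1 ⁻¹' Set.Ici m := by
    refine convexHull_min ?_ ((convex_Ici m).affine_preimage L.1)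
    rintro _ ⟨i, j, hij, rfl⟩
    refine le_trans (hm ?_) (L.2 i j hij)
    simp only [coe_image, Set.mem_image]
    exact ⟨(i, j), by simp; omega, rfl⟩
  exact hsub hx

lemma concaveOn_envelope
    (hne : ∃ L : Plane →ᵃ[ℝ] ℝ, ∀ i j, i + j ≤ n → f i j ≤ L (gridPoint i j)) :
    ConcaveOn ℝ (region n) (envelope n f) := by
  obtain ⟨L₀, hL₀⟩ := hne
  have : Nonempty {L : Plane →ᵃ[ℝ] ℝ // ∀ i j, i + j ≤ n → f i j ≤ L (gridPoint i j)} :=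
    ⟨⟨L₀, hL₀⟩⟩
  refine ⟨convex_convexHull ℝ _, fun x hx y hy a b ha hb hab => le_ciInf fun L => ?_⟩
  rw [Convex.combo_affine_apply hab]
  exact add_le_add (smul_le_smul_of_nonneg_left (ciInf_le (bddBelow_envelope hx) L) ha)
    (smul_le_smul_of_nonneg_left (ciInf_le (bddBelow_envelope hy) L) hb)

/-- Where an affine majorant meets `f`, it agrees with the envelope on the whole convex hull. -/
lemma envelope_eqOn {L : Plane →ᵃ[ℝ] ℝ} {s : Set Plane}
    (hL : ∀ i j, i + j ≤ n → f i j ≤ L (gridPoint i j))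
    (hs : ∀ x ∈ s, ∃ i j, i + j ≤ n ∧ x = gridPoint i j ∧ f i j = L (gridPoint i j)) :
    Set.EqOn (envelope n f) L (convexHull ℝ s) := by
  intro x hx
  have hsv : s ⊆ vertices n := fun y hy => by
    obtain ⟨i, j, hij, rfl, -⟩ := hs y hy
    exact gridPoint_mem_vertices hij
  have : Nonempty {L : Plane →ᵃ[ℝ] ℝ // ∀ i j, i + j ≤ n → f i j ≤ L (gridPoint i j)} :=
    ⟨⟨L, hL⟩⟩
  refine le_antisymm (ciInf_le (bddBelow_envelope (convexHull_mono hsv hx)) ⟨L, hL⟩)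
    (le_ciInf fun L' => ?_)
  have hsub : convexHull ℝ s ⊆ (L'.1 - L) ⁻¹' Set.Ici 0 := by
    refine convexHull_min ?_ ((convex_Ici 0).affine_preimage (L'.1 - L))
    intro y hy
    obtain ⟨i, j, hij, rfl, e⟩ := hs y hy
    have := L'.2 i j hij
    simp only [Set.mem_preimage, AffineMap.coe_sub, Pi.sub_apply, Set.mem_Ici]
    linarith
  have := hsub hx
  simp only [Set.mem_preimage, AffineMap.coe_sub, Pi.sub_apply, Set.mem_Ici] at this
  linarith

end envelope

/-- The rhombus inequality: `u`, `v` are the ends of the short diagonal, `w`, `w'` those of the long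
one; the function is affine on a little triangle containing the short diagonal. -/
lemma rhombus_le {n : ℕ} {g : Plane → ℝ} (hg : ConcaveOn ℝ (region n) g) {u v w w' : Plane}
    {s : Set Plane} {a : Plane →ᵃ[ℝ] ℝ} (ha : Set.EqOn g a (convexHull ℝ s))
    (hu : u ∈ s) (hv : v ∈ s) (hw : w ∈ region n) (hw' : w' ∈ region n) (h : w + w' = u + v) :
    g w + g w' ≤ g u + g v := by
  have hu' := subset_convexHull ℝ s hu
  have hv' := subset_convexHull ℝ s hv
  have hab : (1 / 2 : ℝ) + 1 / 2 = 1 := by norm_num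
  have hm : (1 / 2 : ℝ) • u + (1 / 2 : ℝ) • v ∈ convexHull ℝ s :=
    convex_convexHull ℝ s hu' hv' (by norm_num) (by norm_num) hab
  have h1 := hg.2 hw hw' (by norm_num : (0 : ℝ) ≤ 1 / 2) (by norm_num : (0 : ℝ) ≤ 1 / 2) hab
  have e : (1 / 2 : ℝ) • w + (1 / 2 : ℝ) • w' = (1 / 2 : ℝ) • u + (1 / 2 : ℝ) • v := by
    rw [← smul_add, h, smul_add]
  rw [e, ha hm, Convex.combo_affine_apply hab, ← ha hu', ← ha hv'] at h1
  simp only [smul_eq_mul] at h1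
  linarith

/-! ### The function on the vertices and its affine majorants -/

/-- The value at the vertex `(i, j)`: the entries of row `j` are summed up, and the first summand
makes the function so concave in `j` that rows further away from a little triangle stay below its
plane. The factor `6 * n`, with `n = 2 * k + 4`, suffices since the entries have absolute value at
most `1`. -/
noncomputable def height (k i j : ℕ) : ℝ :=
  -(6 * (2 * k + 4)) * (j : ℝ) ^ 2 + ∑ p ∈ range i, entry k p (2 * k + 3 - j - p)

/-- A supergradient `α` at `m` of the concave sequence of partial sums of `c` gives a majorant. -/
lemma sum_range_le_of_antitone {c : ℕ → ℝ} (hc : Antitone c) {α : ℝ} {m : ℕ} (h1 : c m ≤ α)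
    (h2 : ∀ l, l + 1 = m → α ≤ c l) (i : ℕ) :
    ∑ p ∈ range i, c p ≤ ∑ p ∈ range m, c p + α * (i - m) := by
  rcases le_total m i with h | h
  · obtain ⟨t, rfl⟩ := Nat.exists_eq_add_of_le h
    rw [sum_range_add]
    have := sum_le_card_nsmul (range t) (fun x => c (m + x)) α
      fun x _ => (hc (Nat.le_add_right m x)).trans h1
    simp only [card_range, nsmul_eq_mul] at this
    push_cast
    linarith
  · obtain ⟨t, rfl⟩ := Nat.exists_eq_add_of_le h
    rw [sum_range_add]
    have := card_nsmul_le_sum (range t) (fun x => c (i + x)) α fun x hx => by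
      refine (h2 (i + t - 1) (by grind)).trans (hc (by grind))
    simp only [card_range, nsmul_eq_mul] at this
    push_cast
    linarith

lemma abs_sum_entry_le {k : ℕ} (hk : 0 < k) (i m : ℕ) :
    |∑ p ∈ range i, entry k p (m - p)| ≤ i := by
  refine (abs_sum_le_sum_abs _ _).trans ((sum_le_card_nsmul _ _ 1 fun x _ =>
    abs_entry_le_one hk _ _).trans ?_)
  simp

/-- The affine function with slope `α` along the rows that meets `height` at the vertices `(m, j)`
and `(m, j + 1)`. -/
noncomputable def majorant (k m j : ℕ) (α : ℝ) : Plane →ᵃ[ℝ] ℝ :=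
  AffineMap.const ℝ Plane (height k m j - α * m - (height k m (j + 1) - height k m j) * j) +
    (α • coordI + (height k m (j + 1) - height k m j) • coordJ).toAffineMap

lemma majorant_apply (k m j : ℕ) (α : ℝ) (i' j' : ℕ) :
    majorant k m j α (gridPoint i' j') =
      height k m j + α * (i' - m) + (height k m (j + 1) - height k m j) * (j' - j) := by
  simp [majorant]; ring

/-- The hypotheses say that `α` is a supergradient at `m` of row `j` from the right and of row
`j + 1` from the left; since the pattern is monotone, it is then a supergradient at `m` of both
rows. -/
lemma height_le_majorant {k : ℕ} (hk : 0 < k) {m j : ℕ} {α : ℝ} (hm : m ≤ 2 * k + 4)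
    (hα : |α| ≤ 1)
    (h1 : entry k m (2 * k + 3 - j - m) ≤ α)
    (h2 : ∀ l, l + 1 = m → α ≤ entry k l (2 * k + 3 - (j + 1) - l)) {i' j' : ℕ}
    (hi : i' + j' ≤ 2 * k + 4) :
    height k i' j' ≤ majorant k m j α (gridPoint i' j') := by
  have hanti : ∀ r, Antitone fun p => entry k p (r - p) := fun r p p' h =>
    entry_le_entry hk h (by omega)
  rw [majorant_apply]
  rcases eq_or_ne j' j with rfl | hj
  · have := sum_range_le_of_antitone (hanti (2 * k + 3 - j')) h1
      (fun l hl => (h2 l hl).trans (entry_le_entry hk le_rfl (by omega))) i'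
    simp only [height]
    linarith
  rcases eq_or_ne j' (j + 1) with rfl | hj1
  · have := sum_range_le_of_antitone (hanti (2 * k + 3 - (j + 1)))
      ((entry_le_entry hk le_rfl (by omega)).trans h1) h2 i'
    simp only [height, Nat.cast_add, Nat.cast_one]
    linarith
  -- In the other rows the quadratic summand outweighs crude bounds for everything else.
  have b1 := abs_le.1 (abs_sum_entry_le hk m (2 * k + 3 - j))
  have b2 := abs_le.1 (abs_sum_entry_le hk m (2 * k + 3 - (j + 1)))
  have b3 := abs_le.1 (abs_sum_entry_le hk i' (2 * k + 3 - j'))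
  have hm' : (m : ℝ) ≤ 2 * k + 4 := by exact_mod_cast hm
  have hi' : (i' : ℝ) ≤ 2 * k + 4 := by exact_mod_cast (by omega : i' ≤ 2 * k + 4)
  have b4 : |α * (i' - m)| ≤ 2 * k + 4 := by
    rw [abs_mul]
    have : |(i' : ℝ) - m| ≤ 2 * k + 4 := by
      rw [abs_le]
      constructor <;>
        linarith [(Nat.cast_nonneg i' : (0 : ℝ) ≤ i'), (Nat.cast_nonneg m : (0 : ℝ) ≤ m)]
    calc |α| * |(i' : ℝ) - m| ≤ 1 * |(i' : ℝ) - m| := by gcongr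
      _ ≤ _ := by linarith
  have b4 := abs_le.1 b4
  simp only [height, Nat.cast_add, Nat.cast_one]
  generalize ∑ p ∈ range m, entry k p (2 * k + 3 - j - p) = A at *
  generalize ∑ p ∈ range m, entry k p (2 * k + 3 - (j + 1) - p) = B at *
  generalize ∑ p ∈ range i', entry k p (2 * k + 3 - j' - p) = D at *
  set N : ℝ := 2 * k + 4 with hN
  have hN0 : 0 < N := by positivity
  rcases lt_or_gt_of_ne hj with h | h
  · obtain ⟨t, rfl⟩ := Nat.exists_eq_add_of_lt h
    push_cast
    have ht : (0 : ℝ) ≤ t := Nat.cast_nonneg t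
    nlinarith [mul_nonneg hN0.le ht, mul_nonneg hN0.le (mul_nonneg ht ht),
      mul_nonneg ht (by linarith : 0 ≤ 2 * N - B + A)]
  · obtain ⟨t, rfl⟩ := Nat.exists_eq_add_of_lt (lt_of_le_of_ne h (Ne.symm hj1))
    push_cast
    have ht : (0 : ℝ) ≤ t := Nat.cast_nonneg t
    nlinarith [mul_nonneg hN0.le ht, mul_nonneg hN0.le (mul_nonneg ht ht),
      mul_nonneg ht (by linarith : 0 ≤ 2 * N + B - A)]

lemma height_succ (k i j : ℕ) :
    height k (i + 1) j = height k i j + entry k i (2 * k + 3 - j - i) := by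
  simp [height, sum_range_succ]; ring

/-- Every little triangle spans an affine majorant of `height`: its slope along the rows is that
of its horizontal edge. -/
lemma exists_majorant {k : ℕ} (hk : 0 < k) {u v w : Plane}
    (h : IsThreeCircuit (2 * k + 4) u v w) :
    ∃ L : Plane →ᵃ[ℝ] ℝ,
      (∀ i j, i + j ≤ 2 * k + 4 → height k i j ≤ L (gridPoint i j)) ∧
      ∀ x ∈ ({u, v, w} : Set Plane), ∃ i j, i + j ≤ 2 * k + 4 ∧ x = gridPoint i j ∧
        height k i j = L (gridPoint i j) := by
  obtain ⟨i, j, ⟨hij, hs⟩ | ⟨hij, hs⟩⟩ := h.subset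
  · refine ⟨majorant k i j (entry k i (2 * k + 3 - j - i)), fun i' j' h =>
      height_le_majorant hk (by omega) (abs_entry_le_one hk _ _) le_rfl (fun l hl =>
        entry_le_entry hk (by omega) (by omega)) h, fun x hx => ?_⟩
    rcases hs hx with rfl | rfl | rfl
    · exact ⟨_, _, by omega, rfl, by rw [majorant_apply]; ring⟩
    · exact ⟨_, _, by omega, rfl, by rw [majorant_apply, height_succ]; push_cast; ring⟩
    · exact ⟨_, _, by omega, rfl, by rw [majorant_apply]; push_cast; ring⟩
  · refine ⟨majorant k (i + 1) j (entry k i (2 * k + 3 - (j + 1) - i)), fun i' j' h =>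
      height_le_majorant hk (by omega) (abs_entry_le_one hk _ _)
        (entry_le_entry hk (by omega) (by omega)) (fun l hl => ?_) h, fun x hx => ?_⟩
    · obtain rfl : l = i := by omega
      exact le_rfl
    rcases hs hx with rfl | rfl | rfl
    · exact ⟨_, _, by omega, rfl, by rw [majorant_apply]; ring⟩
    · exact ⟨_, _, by omega, rfl, by
        rw [majorant_apply, height_succ k i (j + 1)]; push_cast; ring⟩
    · exact ⟨_, _, by omega, rfl, by rw [majorant_apply]; push_cast; ring⟩

/-! ### Patterns of concave cocirculations -/

/-- The pattern of a function `g` on the plane: the difference of `g` along the edge of direction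
`ξ₁` from `(p, j)` to `(p + 1, j)`, where `p + j + q = n - 1`. -/
noncomputable def rowDiff (n : ℕ) (g : Plane → ℝ) (p q : ℕ) : ℝ :=
  g (gridPoint (p + 1) (n - 1 - p - q)) - g (gridPoint p (n - 1 - p - q))

section rowDiff

variable {n : ℕ} {g : Plane → ℝ}

/-- The pattern of a concave function is monotone, by two families of rhombus inequalities. -/
lemma rowDiff_le_rowDiff (hg : ConcaveOn ℝ (region n) g)
    (ha : ∀ u v w : Plane, IsThreeCircuit n u v w →
      ∃ a : Plane →ᵃ[ℝ] ℝ, Set.EqOn g a (convexHull ℝ {u, v, w}))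
    {p p' q q' : ℕ} (hp : p ≤ p') (hq : q' ≤ q) (h : p + q + 1 ≤ n) (h' : p' + q' + 1 ≤ n) :
    rowDiff n g p' q' ≤ rowDiff n g p q := by
  have right : ∀ p q, p + q + 2 ≤ n → rowDiff n g p q ≤ rowDiff n g p (q + 1) := by
    intro p q h
    obtain ⟨j, rfl⟩ := Nat.exists_eq_add_of_le h
    obtain ⟨a, ha⟩ := ha _ _ _ (isThreeCircuit_up (n := p + q + 2 + j) (i := p) (j := j) (by omega))
    have := rhombus_le hg ha (u := gridPoint (p + 1) j) (v := gridPoint p (j + 1))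
      (w := gridPoint p j) (w' := gridPoint (p + 1) (j + 1)) (by simp) (by simp)
      (gridPoint_mem_region (by omega)) (gridPoint_mem_region (by omega))
      (ext_coord (by simp; ring) (by simp))
    rw [rowDiff, rowDiff, show p + q + 2 + j - 1 - p - q = j + 1 by omega,
      show p + q + 2 + j - 1 - p - (q + 1) = j by omega]
    linarith
  have left : ∀ p q, p + q + 2 ≤ n → rowDiff n g (p + 1) q ≤ rowDiff n g p q := by
    intro p q h
    obtain ⟨j, rfl⟩ := Nat.exists_eq_add_of_le h
    obtain ⟨a, ha⟩ := ha _ _ _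
      (isThreeCircuit_up (n := p + q + 2 + j) (i := p + 1) (j := j) (by omega))
    have := rhombus_le hg ha (u := gridPoint (p + 1) j) (v := gridPoint (p + 1) (j + 1))
      (w := gridPoint p (j + 1)) (w' := gridPoint (p + 1 + 1) j) (by simp) (by simp)
      (gridPoint_mem_region (by omega)) (gridPoint_mem_region (by omega))
      (ext_coord (by simp; ring) (by simp; ring))
    rw [rowDiff, rowDiff, show p + q + 2 + j - 1 - p - q = j + 1 by omega,
      show p + q + 2 + j - 1 - (p + 1) - q = j by omega]
    linarith
  have h1 : rowDiff n g p' q' ≤ rowDiff n g p q' := by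
    induction p', hp using Nat.le_induction with
    | base => exact le_rfl
    | succ m hm ih => exact (left m q' (by omega)).trans (ih (by omega))
  have h2 : rowDiff n g p q' ≤ rowDiff n g p q := by
    induction q, hq using Nat.le_induction with
    | base => exact le_rfl
    | succ m hm ih => exact (ih (by omega)).trans (right p m (by omega))
  exact h1.trans h2

lemma rowSum_rowDiff {S : ℕ} :
    rowSum (rowDiff n g) S =
      g (gridPoint (S + 1) (n - 1 - S)) - g (gridPoint 0 (n - 1 - S)) := by
  rw [rowSum, ← sum_range_sub (fun p => g (gridPoint p (n - 1 - S)))]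
  refine sum_congr rfl fun p hp => ?_
  rw [rowDiff, show n - 1 - p - (S - p) = n - 1 - S by grind]

end rowDiff

/-- An array for which equalities between comparable entries of the pattern persist is constant on
the tiles, since every tile has a cell that is comparable to all its other cells: a largest or a
smallest one. -/
lemma IsTiled.of_entry_eq {k : ℕ} (hk : 0 < k) {b : ℕ → ℕ → ℝ}
    (hb : ∀ p q p' q', p ≤ p' → q' ≤ q → p + q ≤ 2 * k + 3 → p' + q' ≤ 2 * k + 3 →
      entry k p q = entry k p' q' → b p q = b p' q') :
    IsTiled k b (b 0 k) (b 0 (2 * k + 3)) (b (k + 2) k) (b (2 * k + 3) 0) := by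
  have h := isTiled_entry hk
  have ed := h.low 0 k hk hk le_rfl
  have eu := h.up 0 (2 * k + 3) hk (by omega) (by omega)
  have ez := h.mid (k + 2) k (by omega) le_rfl le_rfl (by omega) (by omega)
  have ev := h.right (2 * k + 3) 0 (by omega) hk (by omega)
  refine ⟨fun p q h1 h2 h3 => ?_, fun p q h1 h2 h3 => ?_, fun q h1 h2 => ?_,
    fun p q h1 h2 h3 h4 h5 => ?_, fun p q h1 h2 h3 => ?_, ?_, ?_⟩
  · exact (hb 0 k p q (by omega) (by omega) (by omega) (by omega)
      (ed.trans (h.low p q h1 h2 h3).symm)).symm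
  · exact (hb 0 (2 * k + 3) p q (by omega) (by omega) (by omega) (by omega)
      (eu.trans (h.up p q h1 h2 h3).symm)).symm
  · exact (hb 0 (2 * k + 3) k q (by omega) (by omega) (by omega) (by omega)
      (eu.trans (h.upTop q h1 h2).symm)).symm
  · exact hb p q (k + 2) k (by omega) (by omega) (by omega) (by omega)
      ((h.mid p q h1 h2 h3 h4 h5).trans ez.symm)
  · exact hb p q (2 * k + 3) 0 (by omega) (by omega) (by omega) (by omega)
      ((h.right p q h1 h2 h3).trans ev.symm)
  · exact hb k 0 (2 * k + 3) 0 (by omega) (by omega) (by omega) (by omega)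
      (h.rightFirst.trans ev.symm)
  · exact hb (k + 3) k (2 * k + 3) 0 (by omega) (by omega) (by omega) (by omega)
      (h.rightLast.trans ev.symm)

/-! ### The sides of the grid -/

lemma gridPoint_zero_mem_side {n j : ℕ} (h : j ≤ n) (hn : 0 < n) :
    gridPoint 0 j ∈ segment ℝ (corner n 2) (corner n (2 + 1)) := by
  have hn' : (0 : ℝ) < n := by exact_mod_cast hn
  have hj : (j : ℝ) ≤ n := by exact_mod_cast h
  refine ⟨j / n, 1 - j / n, by positivity, ?_, by ring, ext_coord ?_ ?_⟩
  · rw [sub_nonneg, div_le_one hn']; exact hj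
  · simp [corner]
  · simp [corner]; field_simp

lemma gridPoint_mem_side_one {n i j : ℕ} (h : i + j = n) (hn : 0 < n) :
    gridPoint i j ∈ segment ℝ (corner n 1) (corner n (1 + 1)) := by
  have hn' : (n : ℝ) ≠ 0 := by positivity
  refine ⟨i / n, j / n, by positivity, by positivity, ?_, ext_coord ?_ ?_⟩
  · rw [← add_div, div_eq_one_iff_eq hn']; exact_mod_cast h
  · simp [corner]; field_simp
  · simp [corner]; field_simp

lemma coord_of_mem_side {n i j : ℕ} {s : Fin 3}
    (h : gridPoint i j ∈ segment ℝ (corner n s) (corner n (s + 1))) :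
    i = 0 ∨ j = 0 ∨ i + j = n := by
  obtain ⟨a, b, -, -, hab, e⟩ := h
  have hI := congrArg coordI e
  have hJ := congrArg coordJ e
  fin_cases s <;> simp [corner] at hI hJ
  · exact Or.inr (Or.inl (by exact_mod_cast hJ.symm))
  · refine Or.inr (Or.inr ?_)
    have : (i : ℝ) + j = n := by rw [← hI, ← hJ, ← add_mul, hab, one_mul]
    exact_mod_cast this
  · exact Or.inl (by exact_mod_cast hI.symm)

lemma height_boundary_int {k : ℕ} (hk : 0 < k) {i j : ℕ} (hij : i + j ≤ 2 * k + 4)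
    (h : i = 0 ∨ j = 0 ∨ i + j = 2 * k + 4) : ∃ m : ℤ, height k i j = m := by
  suffices hs : ∃ m : ℤ, ∑ p ∈ range i, entry k p (2 * k + 3 - j - p) = m by
    obtain ⟨m, hm⟩ := hs
    exact ⟨-(6 * (2 * k + 4)) * j ^ 2 + m, by rw [height, hm]; push_cast; ring⟩
  rcases Nat.eq_zero_or_pos i with rfl | hi
  · exact ⟨0, by simp⟩
  rcases h with h | rfl | h
  · omega
  · choose! m hm using fun p (hp : p < i) =>
      entry_last_int hk (p := p) (q := 2 * k + 3 - 0 - p) (by omega)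
    exact ⟨∑ p ∈ range i, m p, by
      push_cast; exact sum_congr rfl fun p hp => hm p (mem_range.1 hp)⟩
  · obtain ⟨m, hm⟩ := rowSum_entry_int hk (S := i - 1) (by omega)
    refine ⟨m, ?_⟩
    rw [← hm, rowSum, Nat.sub_add_cancel hi]
    refine sum_congr rfl fun p hp => ?_
    rw [show 2 * k + 3 - j - p = i - 1 - p by omega]

/-! ### The vertex of the polyhedron -/

/-- The concave function with pattern `entry`. -/
noncomputable abbrev hive (k : ℕ) : Plane → ℝ := envelope (2 * k + 4) (height k)

lemma hive_gridPoint {k : ℕ} (hk : 0 < k) {i j : ℕ} (hij : i + j ≤ 2 * k + 4) :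
    hive k (gridPoint i j) = height k i j := by
  have key : ∀ i' j', i' + j' + 1 ≤ 2 * k + 4 →
      gridPoint i j ∈ ({gridPoint i' j', gridPoint (i' + 1) j', gridPoint i' (j' + 1)} :
        Set Plane) → hive k (gridPoint i j) = height k i j := by
    intro i' j' h hmem
    obtain ⟨L, hL, hs⟩ := exists_majorant hk (isThreeCircuit_up h)
    rw [hive, envelope_eqOn hL hs (subset_convexHull ℝ _ hmem)]
    obtain ⟨a, b, -, e, h⟩ := hs _ hmem
    obtain ⟨rfl, rfl⟩ := gridPoint_inj.1 e
    exact h.symm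
  rcases Nat.lt_or_ge (i + j) (2 * k + 4) with h | h
  · exact key i j h (by simp)
  rcases j with _ | j
  · exact key (i - 1) 0 (by omega) (by simp; omega)
  · exact key i j (by omega) (by simp)

lemma rowDiff_hive {k : ℕ} (hk : 0 < k) {p q : ℕ} (h : p + q ≤ 2 * k + 3) :
    rowDiff (2 * k + 4) (hive k) p q = entry k p q := by
  rw [rowDiff, hive_gridPoint hk (by omega), hive_gridPoint hk (by omega), height_succ,
    show 2 * k + 3 - (2 * k + 4 - 1 - p - q) - p = q by omega]
  ring

/-- The concave cocirculation of `hive`. -/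
noncomputable def hiveCocirculation (k : ℕ) (e : edges (2 * k + 4)) : ℝ :=
  hive k e.1.2 - hive k e.1.1

lemma isConcaveCocirculation_hive {k : ℕ} (hk : 0 < k) :
    IsConcaveCocirculation (2 * k + 4) (hiveCocirculation k) := by
  refine ⟨hive k, concaveOn_envelope ?_, fun u v w h => ?_, fun e => rfl⟩
  · obtain ⟨L, hL, -⟩ :=
      exists_majorant hk (isThreeCircuit_up (n := 2 * k + 4) (i := 0) (j := 0) (by omega))
    exact ⟨L, hL⟩
  · obtain ⟨L, hL, hs⟩ := exists_majorant hk h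
    exact ⟨L, envelope_eqOn hL hs⟩

lemma hiveCocirculation_boundary_int {k : ℕ} (hk : 0 < k) (e : edges (2 * k + 4))
    (he : e ∈ boundary (2 * k + 4)) : ∃ z : ℤ, hiveCocirculation k e = z := by
  obtain ⟨s, h1, h2⟩ := Set.mem_iUnion.1 he
  obtain ⟨i, j, hij, hu⟩ := e.2.1
  obtain ⟨i', j', hij', hv⟩ := e.2.2.1
  rw [hu] at h1
  rw [hv] at h2
  obtain ⟨m, hm⟩ := height_boundary_int hk hij (coord_of_mem_side h1)
  obtain ⟨m', hm'⟩ := height_boundary_int hk hij' (coord_of_mem_side h2)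
  refine ⟨m' - m, ?_⟩
  rw [hiveCocirculation, hu, hv, hive_gridPoint hk hij, hive_gridPoint hk hij', hm, hm']
  push_cast
  ring

/-- A cocirculation with the right values on two sides and a pattern that is constant on the tiles
is `hiveCocirculation`. -/
lemma cocirculation_eq_of_rowDiff_tiled {k : ℕ} (hk : 0 < k) {g : Plane → ℝ}
    {h : edges (2 * k + 4) → ℝ} (hg : ∀ e, h e = g e.1.2 - g e.1.1)
    (hside : ∀ e ∈ side (2 * k + 4) 1 ∪ side (2 * k + 4) 2, h e = hiveCocirculation k e)
    (htile : ∃ d u z v, IsTiled k (rowDiff (2 * k + 4) g) d u z v) :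
    h = hiveCocirculation k := by
  obtain ⟨d, u, z, v, htile⟩ := htile
  have hn0 : 0 < 2 * k + 4 := by omega
  -- `D` is shown to be constant: on the slanted sides, and then along the rows.
  let D : ℕ → ℕ → ℝ := fun i j => g (gridPoint i j) - hive k (gridPoint i j)
  have hleft : ∀ j ≤ 2 * k + 4, D 0 j = D 0 0 := by
    intro j
    induction j with
    | zero => intro; rfl
    | succ j ih =>
      intro hj
      rw [← ih (by omega)]
      have := hside ⟨_, edge_rising_mem (n := 2 * k + 4) (i := 0) (j := j) (by omega)⟩
        (Or.inr ⟨gridPoint_zero_mem_side hj hn0, gridPoint_zero_mem_side (by omega) hn0⟩)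
      rw [hg, hiveCocirculation] at this
      simp only [D]
      linarith
  have hright : ∀ i j, i + j = 2 * k + 4 → D i j = D 0 (2 * k + 4) := by
    intro i
    induction i with
    | zero => intro j hj; rw [← hj, zero_add]
    | succ i ih =>
      intro j hj
      rw [← ih (j + 1) (by omega)]
      have := hside ⟨_, edge_falling_mem (n := 2 * k + 4) (i := i) (j := j) (by omega)⟩
        (Or.inl ⟨gridPoint_mem_side_one hj hn0, gridPoint_mem_side_one (by omega) hn0⟩)
      rw [hg, hiveCocirculation] at this
      simp only [D]
      linarith
  have hsum : ∀ S ≤ 2 * k + 3, rowSum (rowDiff (2 * k + 4) g) S = rowSum (entry k) S := by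
    intro S hS
    have e : rowSum (entry k) S = rowSum (rowDiff (2 * k + 4) (hive k)) S :=
      sum_congr rfl fun p hp => (rowDiff_hive hk (by grind)).symm
    have h1 := hleft (2 * k + 4 - 1 - S) (by omega)
    have h2 := hright (S + 1) (2 * k + 4 - 1 - S) (by omega)
    have h3 := hleft (2 * k + 4) le_rfl
    rw [e, rowSum_rowDiff, rowSum_rowDiff]
    simp only [D] at h1 h2 h3
    linarith
  have hrow : ∀ i j, i + j ≤ 2 * k + 4 → D i j = D 0 0 := by
    intro i
    induction i with
    | zero => intro j hj; exact hleft j (by omega)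
    | succ i ih =>
      intro j hj
      rw [← ih j (by omega)]
      have h1 := htile.eq_of_rowSum_eq hk (isTiled_entry hk) hsum (p := i)
        (q := 2 * k + 4 - 1 - i - j) (by omega)
      rw [← rowDiff_hive hk (by omega), rowDiff, rowDiff,
        show 2 * k + 4 - 1 - i - (2 * k + 4 - 1 - i - j) = j by omega] at h1
      simp only [D]
      linarith
  funext e
  obtain ⟨i, j, hij, hu⟩ := e.2.1
  obtain ⟨i', j', hij', hv⟩ := e.2.2.1
  have h1 := hrow i j hij
  have h2 := hrow i' j' hij'
  rw [hg, hiveCocirculation, hu, hv]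
  simp only [D] at h1 h2
  linarith

lemma rowDiff_combination_eq_entry {k : ℕ} (hk : 0 < k) {g₁ g₂ : Plane → ℝ}
    {h₁ h₂ : edges (2 * k + 4) → ℝ}
    (hg₁ : ∀ e, h₁ e = g₁ e.1.2 - g₁ e.1.1) (hg₂ : ∀ e, h₂ e = g₂ e.1.2 - g₂ e.1.1) {s t : ℝ}
    (hh : s • h₁ + t • h₂ = hiveCocirculation k) {p q : ℕ} (hpq : p + q ≤ 2 * k + 3) :
    s * rowDiff (2 * k + 4) g₁ p q + t * rowDiff (2 * k + 4) g₂ p q = entry k p q := by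
  have := congrFun hh ⟨_, edge_horizontal_mem (n := 2 * k + 4) (i := p)
    (j := 2 * k + 4 - 1 - p - q) (by omega)⟩
  simp only [Pi.add_apply, Pi.smul_apply, smul_eq_mul, hg₁, hg₂, hiveCocirculation] at this
  rw [← rowDiff_hive hk hpq]
  exact this

theorem hiveCocirculation_mem_extremePoints {k : ℕ} (hk : 0 < k)
    {h₀ : ↥(side (2 * k + 4) 1 ∪ side (2 * k + 4) 2) → ℝ}
    (h₀_eq : ∀ e, hiveCocirculation k e.1 = h₀ e) :
    hiveCocirculation k ∈
      (polyhedron (2 * k + 4) (side (2 * k + 4) 1 ∪ side (2 * k + 4) 2) h₀).extremePoints ℝ := by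
  refine ⟨⟨isConcaveCocirculation_hive hk, h₀_eq⟩, ?_⟩
  rintro h₁ ⟨⟨g₁, hc₁, ha₁, hg₁⟩, hs₁⟩ h₂ ⟨⟨g₂, hc₂, ha₂, hg₂⟩, -⟩ ⟨s, t, hs, ht, -, hh⟩
  refine cocirculation_eq_of_rowDiff_tiled hk hg₁
    (fun e he => (hs₁ ⟨e, he⟩).trans (h₀_eq ⟨e, he⟩).symm)
    ⟨_, _, _, _, IsTiled.of_entry_eq hk fun p q p' q' hp hq hpq hpq' heq => ?_⟩
  have m₁ := rowDiff_le_rowDiff hc₁ ha₁ hp hq (by omega) (by omega)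
  have m₂ := rowDiff_le_rowDiff hc₂ ha₂ hp hq (by omega) (by omega)
  rw [← rowDiff_combination_eq_entry hk hg₁ hg₂ hh hpq,
    ← rowDiff_combination_eq_entry hk hg₁ hg₂ hh hpq'] at heq
  have n₂ := mul_le_mul_of_nonneg_left m₂ ht.le
  exact le_antisymm (le_of_mul_le_mul_left (by linarith) hs) m₁

end TriGrid

theorem theorem3 :
    ∃ C : ℕ, ∀ k : ℕ, 0 < k →
      ∃ n : ℕ, 0 < n ∧ n ≤ C * k ∧
        ∃ s t : Fin 3, s ≠ t ∧
          ∃ h₀ : ↥(TriGrid.side n s ∪ TriGrid.side n t) → ℤ,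
            ∃ h ∈ (TriGrid.polyhedron n (TriGrid.side n s ∪ TriGrid.side n t)
                (fun e => (h₀ e : ℝ))).extremePoints ℝ,
              (∃ e : TriGrid.edges n, ∃ q : ℚ, h e = (q : ℝ) ∧ q.den = k) ∧
              (∀ e ∈ TriGrid.boundary n, ∃ z : ℤ, h e = (z : ℝ)) := by
  refine ⟨6, fun k hk => ⟨2 * k + 4, by omega, by omega, 1, 2, by decide, ?_⟩⟩
  have hint := TriGrid.hiveCocirculation_boundary_int hk
  choose z hz using hint
  have hsub : ∀ e ∈ TriGrid.side (2 * k + 4) 1 ∪ TriGrid.side (2 * k + 4) 2,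
      e ∈ TriGrid.boundary (2 * k + 4) := by
    rintro e (he | he)
    · exact Set.mem_iUnion.2 ⟨1, he⟩
    · exact Set.mem_iUnion.2 ⟨2, he⟩
  refine ⟨fun e => z e.1 (hsub e.1 e.2), TriGrid.hiveCocirculation k,
    TriGrid.hiveCocirculation_mem_extremePoints hk fun e => hz _ _, ?_,
    fun e he => ⟨z e he, hz e he⟩⟩
  refine ⟨⟨_, TriGrid.edge_horizontal_mem (n := 2 * k + 4) (i := 0)
    (j := 2 * k + 4 - 1 - 0 - 1) (by omega)⟩, (k : ℚ)⁻¹, ?_, Rat.inv_natCast_den_of_pos hk⟩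
  have h1 := TriGrid.rowDiff_hive hk (p := 0) (q := 1) (by omega)
  rw [(TriGrid.isTiled_entry hk).low 0 1 hk le_rfl hk] at h1
  push_cast
  rw [← one_div]
  exact h1
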